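/- Consider $N$ sensors. Sensor $j$ observes $\mathbf x_j=[\mathbf x_{j1}^T,\dots,\mathbf x_{jL_j}^T]^T$, where the subvector $\mathbf x_{jl}$ takes values in a measurable space $\mathscr X_{jl}$ and the law of the observations depends on a parameter $\boldsymbol\theta\in\boldsymbol\Theta\subset\mathbb R^{D}$. Each $\mathbf x_{jl}$ is quantized to $u_{jl}=\sum_{r=1}^{R_{jl}} r\,\mathbb 1\{\mathbf x_{jl}\in I_{jl}^{(r)}\}$, where the measurable regions $I_{jl}^{(1)},\dots,I_{jl}^{(R_{jl})}$ are disjoint and cover $\mathscr X_{jl}$. Put $\mathbf u_j=[u_{j1},\dots,u_{jL_j}]^T$ and $\mathbf u=[\mathbf u_1^T,\dots,\mathbf u_N^T]^T$. For $\mathbf s\in\mathcal S_j=\prod_{l}\{1,\dots,R_{jl}\}$ put $q_j^{(\mathbf s)}(\boldsymbol\theta)=\Pr(\mathbf u_j=\mathbf s\mid\boldsymbol\theta)$. Assume that $\boldsymbol\Theta$ has nonempty interior, that for every $\boldsymbol\theta\in\boldsymbol\Theta$ all the subvectors $\{\mathbf x_{jl}\}_{j,l}$ are independent, and that $$D>\lambda_{\mathrm{Indep}}:=\sum_{j=1}^N\sum_{l=1}^{L_j}R_{jl}-\sum_{j=1}^N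 L_j .$$ (a) Suppose that every $q_j^{(\mathbf s)}$ is twice differentiable on $\boldsymbol\Theta$. (At points of $\boldsymbol\Theta$ that are not interior, derivatives are taken along $\boldsymbol\Theta$, and $\boldsymbol\theta$ is restricted to points where they are uniquely determined.) Then the Fisher information matrix $$\mathbf J(\boldsymbol\theta)=\sum_{j=1}^N\sum_{\mathbf s\in\mathcal S_j}\frac1{q_j^{(\mathbf s)}(\boldsymbol\theta)}\frac{\partial q_j^{(\mathbf s)}(\boldsymbol\theta)}{\partial\boldsymbol\theta}\left[\frac{\partial q_j^{(\mathbf s)}(\boldsymbol\theta)}{\partial\boldsymbol\theta}\right]^T,$$ where terms with $q_j^{(\mathbf s)}(\boldsymbol\theta)=0$ are omitted, is singular for every such $\boldsymbol\theta\in\boldsymbol\Theta$. The matrix with entries $-\mathbb E\left\{\partial^2\ln\Pr(\mathbf u\mid\boldsymbol\theta)/\partial\theta_a\partial\theta_b\right\}$ is also singular at every $\boldsymbol\theta\in\boldsymbol\Theta$ near which derivatives along $\boldsymbol\Theta$ are uniquely determined (for example every interior point) and at which each $q_j^{(\mathbf s)}$ is either positive or vanishes identically on $\boldsymbol\Theta$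 near $\boldsymbol\theta$. (b) Suppose that every $q_j^{(\mathbf s)}$ is continuous on $\boldsymbol\Theta$. Call $\boldsymbol\theta\in\boldsymbol\Theta$ identifiable if there is no $\boldsymbol\theta'\in\boldsymbol\Theta\setminus\{\boldsymbol\theta\}$ with $\Pr(\mathbf u\mid\boldsymbol\theta)=\Pr(\mathbf u\mid\boldsymbol\theta')$ for all possible $\mathbf u$, and call $\boldsymbol\Theta$ identifiable if all its points are. Then $\boldsymbol\Theta$ is not identifiable. Moreover, every nonempty set $\mathcal U\subset\boldsymbol\Theta$ that is open in $\mathbb R^{D}$ contains infinitely many points that are not identifiable. -/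

import Mathlib

open MeasureTheory ProbabilityTheory Topology

noncomputable section

/-- A vector quantizer with `R` levels on a measurable space `X`: measurable quantization regions,
pairwise disjoint, covering `X`. (Regions may be empty.) -/
structure VectorQuantizer (X : Type*) [MeasurableSpace X] (R : ℕ) where
  region : Fin R → Set X
  measurableSet_region : ∀ r, MeasurableSet (region r)
  disjoint_region : Pairwise fun r r' => Disjoint (region r) (region r')
  cover : (⋃ r, region r) = Set.univ

/-- The quantized value of `y`, the sum over `r` of `r` times the indicator of the `r`-th region.
The `R` regions are indexed by `Fin R`, so the level of `r : Fin R` is `r + 1`. -/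
def VectorQuantizer.quantize {X : Type*} [MeasurableSpace X] {R : ℕ}
    (γ : VectorQuantizer X R) (y : X) : ℕ :=
  ∑ r : Fin R, (γ.region r).indicator (fun _ => (r : ℕ) + 1) y

section System

variable {N D : ℕ} {L : Fin N → ℕ} {R : ∀ j, Fin (L j) → ℕ}
  {X : ∀ j, Fin (L j) → Type*} [∀ j l, MeasurableSpace (X j l)]
  {Ω : Type*} [MeasurableSpace Ω]

/-- The superquantizer of sensor `j`: each subvector is quantized by its own vector quantizer. -/
def superquantize (γ : ∀ j l, VectorQuantizer (X j l) (R j l)) (j : Fin N)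
    (y : ∀ l, X j l) : Fin (L j) → ℕ :=
  fun l => (γ j l).quantize (y l)

/-- The possible outcomes of the superquantizer of sensor `j`. The index `s` stands for
the vector of levels whose `l`-th entry is `s l + 1`. -/
abbrev Outcome (R : ∀ j, Fin (L j) → ℕ) (j : Fin N) : Type := ∀ l : Fin (L j), Fin (R j l)

/-- The probability, under the parameter `θ`, that sensor `j` outputs `s`. -/
def outcomeProb (γ : ∀ j l, VectorQuantizer (X j l) (R j l)) (x : ∀ j l, Ω → X j l)
    (P : EuclideanSpace ℝ (Fin D) → Measure Ω) (j : Fin N) (s : Outcome R j)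
    (θ : EuclideanSpace ℝ (Fin D)) : ℝ :=
  (P θ).real {ω | superquantize γ j (fun l => x j l ω) = fun l => (s l : ℕ) + 1}

/-- The probability, under the parameter `θ`, of the total quantized data `u`. -/
def dataProb (γ : ∀ j l, VectorQuantizer (X j l) (R j l)) (x : ∀ j l, Ω → X j l)
    (P : EuclideanSpace ℝ (Fin D) → Measure Ω) (u : ∀ j, Outcome R j)
    (θ : EuclideanSpace ℝ (Fin D)) : ℝ :=
  (P θ).real {ω | ∀ j, superquantize γ j (fun l => x j l ω) = fun l => (u j l : ℕ) + 1}

/-- The log-likelihood of `θ` given the quantized data `u`. -/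
def logLikelihood (γ : ∀ j l, VectorQuantizer (X j l) (R j l)) (x : ∀ j l, Ω → X j l)
    (P : EuclideanSpace ℝ (Fin D) → Measure Ω) (u : ∀ j, Outcome R j)
    (θ : EuclideanSpace ℝ (Fin D)) : ℝ :=
  Real.log (dataProb γ x P u θ)

/-- The partial derivative in the `k`-th coordinate of a function on `Θ`. It is taken within `Θ`,
so it depends on the values of `f` on `Θ` only; at interior points it is the usual one. -/
def partialOn (Θ : Set (EuclideanSpace ℝ (Fin D))) (k : Fin D)
    (f : EuclideanSpace ℝ (Fin D) → ℝ) (θ : EuclideanSpace ℝ (Fin D)) : ℝ :=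
  fderivWithin ℝ f Θ θ (EuclideanSpace.single k 1)

/-- `f` is twice (Fréchet) differentiable at all points of `Θ`, as a function on `Θ`. -/
def TwiceDifferentiableOn (f : EuclideanSpace ℝ (Fin D) → ℝ)
    (Θ : Set (EuclideanSpace ℝ (Fin D))) : Prop :=
  ∃ f' : EuclideanSpace ℝ (Fin D) → (EuclideanSpace ℝ (Fin D) →L[ℝ] ℝ),
    (∀ θ ∈ Θ, HasFDerivWithinAt f (f' θ) Θ θ) ∧ DifferentiableOn ℝ f' Θ

/-- The Fisher information matrix as minus the expected Hessian of the log-likelihood. -/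
def fisherHessian (γ : ∀ j l, VectorQuantizer (X j l) (R j l)) (x : ∀ j l, Ω → X j l)
    (P : EuclideanSpace ℝ (Fin D) → Measure Ω) (Θ : Set (EuclideanSpace ℝ (Fin D)))
    (θ : EuclideanSpace ℝ (Fin D)) : Matrix (Fin D) (Fin D) ℝ :=
  Matrix.of fun a b => - ∑ u : ∀ j, Outcome R j,
    dataProb γ x P u θ * partialOn Θ a (partialOn Θ b (logLikelihood γ x P u)) θ

/-- The Fisher information matrix in gradient form: the sum over all sensors and outcomes of
`(1 / q) ∇q (∇q)ᵀ`. Outcomes with `q = 0` at `θ` are left out (`1 / 0 = 0`). -/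
def fisherGradient (γ : ∀ j l, VectorQuantizer (X j l) (R j l)) (x : ∀ j l, Ω → X j l)
    (P : EuclideanSpace ℝ (Fin D) → Measure Ω) (Θ : Set (EuclideanSpace ℝ (Fin D)))
    (θ : EuclideanSpace ℝ (Fin D)) : Matrix (Fin D) (Fin D) ℝ :=
  Matrix.of fun a b => ∑ j, ∑ s : Outcome R j, (1 / outcomeProb γ x P j s θ) *
    (partialOn Θ a (outcomeProb γ x P j s) θ * partialOn Θ b (outcomeProb γ x P j s) θ)

/-- Two distinct parameter points give the same distribution of the quantized data. -/
def ObservationallyEquivalent (γ : ∀ j l, VectorQuantizer (X j l) (R j l))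
    (x : ∀ j l, Ω → X j l) (P : EuclideanSpace ℝ (Fin D) → Measure Ω)
    (θ θ' : EuclideanSpace ℝ (Fin D)) : Prop :=
  θ ≠ θ' ∧ ∀ u : ∀ j, Outcome R j, dataProb γ x P u θ = dataProb γ x P u θ'

/-- `θ` is an identifiable point of the parameter space `Θ`. -/
def IdentifiablePoint (γ : ∀ j l, VectorQuantizer (X j l) (R j l)) (x : ∀ j l, Ω → X j l)
    (P : EuclideanSpace ℝ (Fin D) → Measure Ω) (Θ : Set (EuclideanSpace ℝ (Fin D)))
    (θ : EuclideanSpace ℝ (Fin D)) : Prop :=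
  ¬ ∃ θ' ∈ Θ, ObservationallyEquivalent γ x P θ θ'

/-- The parameter space `Θ` is identifiable. -/
def IdentifiableSpace (γ : ∀ j l, VectorQuantizer (X j l) (R j l)) (x : ∀ j l, Ω → X j l)
    (P : EuclideanSpace ℝ (Fin D) → Measure Ω) (Θ : Set (EuclideanSpace ℝ (Fin D))) : Prop :=
  ∀ θ ∈ Θ, IdentifiablePoint γ x P Θ θ

/-- The refined inestimable dimension for independent observation subvectors. -/
def lambdaIndep (R : ∀ j, Fin (L j) → ℕ) : ℤ :=
  (∑ j, ∑ l, (R j l : ℤ)) - ∑ j, (L j : ℤ)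

end System

end

/-! By independence, the law of `u` is determined by the probabilities `levelProb` that each
subvector falls in each of its regions. For one subvector these sum to 1, so one may be dropped.
What remains is a map from `Θ` to a space of dimension `lambdaIndep R < D`, and the law of `u`
factors through it. Level probabilities are marginals, i.e. finite sums, of the `outcomeProb`s, so
they inherit differentiability and continuity.

(a) The derivative of this map kills some `v ≠ 0` (`exists_fderivWithin_eq_zero`), and by the
product rule `v` kills the derivative of every outcome and data probability. The gradient-form
matrix is a sum of multiples of `∇q (∇q)ᵀ`, so `v` lies in its kernel. The Hessian form reduces to
the same shape: `p ∂∂ log p = ∂∂p - (1/p) ∂p ∂p`, and the terms `∂∂p` add up to zero because the `p`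
add up to 1.

(b) A continuous map from a nonempty open set of `ℝ^D` to a space of smaller dimension is not
injective (`not_injOn_of_continuousOn_of_card_lt`). If `f` were injective, Stone–Weierstrass would
give a polynomial map `p` with `p ∘ f` close to the identity on a ball. The range of `p` has dense
complement, so it misses some small `c`; yet `p ∘ f - c`, still close to the identity, must have a
zero. That zero comes from the no-retraction theorem, proved by the volume argument of Milnor and
Rogers. -/

noncomputable section

/-! ### The no-retraction theorem. -/

/-- Since `t ↦ det (1 + t A)` is a polynomial of bounded degree, its value at `1` is an affine
combination of its values at prescribed nodes, with weights that do not depend on `A`. -/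
theorem exists_det_one_add_eq_sum (E : Type*) [NormedAddCommGroup E] [NormedSpace ℝ E]
    [FiniteDimensional ℝ E] {N : ℕ} (hN : Module.finrank ℝ E < N) {t : Fin N → ℝ}
    (ht : Function.Injective t) :
    ∃ c : Fin N → ℝ, ∑ i, c i = 1 ∧
      ∀ A : E →L[ℝ] E, (1 + A).det = ∑ i, c i * (1 + t i • A).det := by
  classical
  have hinj : Set.InjOn t ((Finset.univ : Finset (Fin N)) : Set (Fin N)) := ht.injOn
  have : Nonempty (Fin N) := ⟨⟨0, by omega⟩⟩
  refine ⟨fun i => (Lagrange.basis Finset.univ t i).eval 1, ?_, fun A => ?_⟩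
  · have := congrArg (Polynomial.eval 1) (Lagrange.sum_basis hinj Finset.univ_nonempty)
    simpa [Polynomial.eval_finsetSum] using this
  · let b := Module.finBasis ℝ E
    let M := LinearMap.toMatrix b b (A : E →ₗ[ℝ] E)
    let p : Polynomial ℝ := ((Polynomial.X : Polynomial ℝ) •
      M.map (Polynomial.C : ℝ →+* Polynomial ℝ)
      + (1 : Matrix (Fin (Module.finrank ℝ E)) (Fin (Module.finrank ℝ E)) ℝ).map
        (Polynomial.C : ℝ →+* Polynomial ℝ)).det
    have hp : ∀ s : ℝ, p.eval s = (1 + s • A).det := by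
      intro s
      rw [ContinuousLinearMap.det, ← LinearMap.det_toMatrix b]
      have h1 := RingHom.map_det (Polynomial.evalRingHom s)
        ((Polynomial.X : Polynomial ℝ) • M.map (Polynomial.C : ℝ →+* Polynomial ℝ)
        + (1 : Matrix (Fin (Module.finrank ℝ E)) (Fin (Module.finrank ℝ E)) ℝ).map
        (Polynomial.C : ℝ →+* Polynomial ℝ))
      rw [Polynomial.coe_evalRingHom] at h1
      have h2 : LinearMap.toMatrix b b ((1 + s • A : E →L[ℝ] E) : E →ₗ[ℝ] E) = 1 + s • M := by
        rw [ContinuousLinearMap.toLinearMap_add, ContinuousLinearMap.toLinearMap_smul,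
          (LinearMap.toMatrix b b).map_add, (LinearMap.toMatrix b b).map_smul]
        congr 1
        exact LinearMap.toMatrix_one b
      rw [h1, h2]
      congr 1
      ext i j
      simp [M, Matrix.one_apply, add_comm, apply_ite (Polynomial.eval s)]
      exact mul_comm _ _
    have hdeg : p.degree < (Finset.univ : Finset (Fin N)).card := by
      refine lt_of_le_of_lt Polynomial.degree_le_natDegree ?_
      have := Polynomial.natDegree_det_X_add_C_le M 1
      rw [Fintype.card_fin] at this
      rw [Finset.card_univ, Fintype.card_fin]
      exact_mod_cast lt_of_le_of_lt this hN
    have h := congrArg (Polynomial.eval 1) (Lagrange.eq_interpolate hinj hdeg)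
    rw [hp, one_smul, Lagrange.interpolate_apply, Polynomial.eval_finsetSum] at h
    rw [h]
    refine Finset.sum_congr rfl fun i _ => ?_
    rw [Polynomial.eval_mul, Polynomial.eval_C, hp, mul_comm]

/-- A segment from inside the ball to outside crosses the unit sphere, where `g` vanishes; the bound
on the inner piece is enough, with the same constant. -/
theorem lipschitzWith_of_eq_zero_outside_closedBall {E F : Type*} [NormedAddCommGroup E]
    [NormedSpace ℝ E] [NormedAddCommGroup F] {g : E → F} {K : NNReal}
    (hg : LipschitzOnWith K g (Metric.closedBall 0 1)) (h0 : ∀ x, 1 ≤ ‖x‖ → g x = 0) :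
    LipschitzWith K g := by
  have key : ∀ x y : E, ‖x‖ ≤ 1 → 1 ≤ ‖y‖ → dist (g x) (g y) ≤ K * dist x y := by
    intro x y hx hy
    have hcont : ContinuousOn (fun s : ℝ => ‖x + s • (y - x)‖) (Set.Icc 0 1) := by fun_prop
    obtain ⟨s, hs, hs1⟩ := intermediate_value_Icc zero_le_one hcont
      (show (1 : ℝ) ∈ Set.Icc _ _ by simp [hx, hy])
    simp only at hs1
    have h1 : dist (g x) (g (x + s • (y - x))) ≤ K * dist x (x + s • (y - x)) :=
      hg.dist_le_mul x (by simpa using hx) _ (by simp [hs1])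
    rw [h0 _ hs1.ge, ← h0 y hy] at h1
    refine h1.trans (mul_le_mul_of_nonneg_left ?_ K.2)
    rw [dist_self_add_right, norm_smul, dist_comm x y, dist_eq_norm, Real.norm_of_nonneg hs.1]
    exact mul_le_of_le_one_left (norm_nonneg _) hs.2
  refine LipschitzWith.of_dist_le_mul fun x y => ?_
  rcases le_total ‖x‖ 1 with hx | hx <;> rcases le_total ‖y‖ 1 with hy | hy
  · exact hg.dist_le_mul x (by simpa using hx) y (by simpa using hy)
  · exact key x y hx hy
  · rw [dist_comm, dist_comm x]; exact key y x hy hx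
  · rw [h0 x hx, h0 y hy, dist_self]; positivity

/-- A small Lipschitz perturbation of the identity supported in a ball maps the open ball
bijectively onto itself. -/
theorem injOn_image_ball_id_add {E : Type*} [NormedAddCommGroup E] [NormedSpace ℝ E]
    [CompleteSpace E] {g : E → E} {K : NNReal} (hg : LipschitzWith K g) (hK : K < 1)
    (h0 : ∀ x, 1 ≤ ‖x‖ → g x = 0) :
    Function.Injective (fun x => x + g x) ∧
      (fun x => x + g x) '' Metric.ball 0 1 = Metric.ball 0 1 := by
  have hA : ApproximatesLinearOn (fun x => x + g x)
      ((ContinuousLinearEquiv.refl ℝ E : E ≃L[ℝ] E) : E →L[ℝ] E) Set.univ K := by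
    rw [ApproximatesLinearOn.approximatesLinearOn_iff_lipschitzOnWith, lipschitzOnWith_univ]
    convert hg using 1
    ext x; simp
  have hc : Subsingleton E ∨ K < ‖((ContinuousLinearEquiv.refl ℝ E).symm : E →L[ℝ] E)‖₊⁻¹ := by
    rcases subsingleton_or_nontrivial E with h | h
    · exact Or.inl h
    · right
      simpa using hK
  have hbij : Function.Bijective (fun x => x + g x) := (hA.toHomeomorph _ hc).bijective
  refine ⟨hbij.1, ?_⟩
  -- The map is a bijection of the whole space that fixes every point outside the open ball, so it
  -- must preserve the ball.
  have hcompl : (fun x => x + g x) '' (Metric.ball 0 1)ᶜ = (Metric.ball 0 1)ᶜ := by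
    have : Set.EqOn (fun x => x + g x) id (Metric.ball 0 1)ᶜ := by
      intro x hx
      simp [h0 x (by simpa using hx)]
    rw [this.image_eq, Set.image_id]
  rw [Set.image_compl_eq hbij] at hcompl
  exact compl_injective hcompl

/-- Differentiating `⟪r, r⟫ = 1` shows that the range of `r'` is orthogonal to the unit vector `r
x`, so `r'` is not onto. -/
theorem det_eq_zero_of_hasFDerivAt_of_norm_eq_one {E : Type*} [NormedAddCommGroup E]
    [InnerProductSpace ℝ E] [FiniteDimensional ℝ E] {r : E → E} {r' : E →L[ℝ] E} {x : E}
    (hr : HasFDerivAt r r' x) (hn : ∀ᶠ y in 𝓝 x, ‖r y‖ = 1) : r'.det = 0 := by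
  have h1 : HasFDerivAt (fun y => inner ℝ (r y) (r y)) (0 : E →L[ℝ] ℝ) x := by
    refine (hasFDerivAt_const (1 : ℝ) x).congr_of_eventuallyEq ?_
    filter_upwards [hn] with y hy
    rw [real_inner_self_eq_norm_sq, hy]; norm_num
  have h2 := (hr.inner ℝ hr).unique h1
  by_contra hdet
  have hs : Function.Surjective r' := by
    have : IsUnit (LinearMap.det (r' : E →ₗ[ℝ] E)) := isUnit_iff_ne_zero.2 hdet
    exact ((LinearMap.isUnit_iff_isUnit_det _).2 this |> (Module.End.isUnit_iff _).1).2
  obtain ⟨v, hv⟩ := hs (r x)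
  have h3 := DFunLike.congr_fun h2 v
  simp [hv, hn.self_of_nhds] at h3

/-- There is no `C¹` retraction of the closed unit ball onto the unit sphere. -/
theorem not_contDiff_retraction {E : Type*} [NormedAddCommGroup E]
    [InnerProductSpace ℝ E] [FiniteDimensional ℝ E] {r : E → E} (hr : ContDiff ℝ 1 r)
    (hn : ∀ x, ‖x‖ ≤ 1 → ‖r x‖ = 1) (hid : ∀ x, ‖x‖ = 1 → r x = x) : False := by
  classical
  borelize E
  let B : Set E := Metric.ball 0 1
  let μ : Measure E := Measure.addHaar
  -- For small `t > 0` the map `x + t • g x` carries the ball bijectively onto itself with positive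
  -- Jacobian, so the integral of `det (1 + t A)` is the volume of the ball. This integral is
  -- polynomial in `t`, so the same holds at `t = 1`, where `det (1 + A) = det r'` vanishes: a
  -- contradiction.
  let A : E → E →L[ℝ] E := fun x => fderiv ℝ r x - 1
  have hA : Continuous A := (hr.continuous_fderiv one_ne_zero).sub continuous_const
  let g : E → E := fun x => if ‖x‖ ≤ 1 then r x - x else 0
  have hg0 : ∀ x, 1 ≤ ‖x‖ → g x = 0 := by
    intro x hx
    by_cases h : ‖x‖ ≤ 1
    · simp [g, hid x (le_antisymm h hx)]
    · simp [g, h]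
  obtain ⟨K, hK⟩ : ∃ K, LipschitzOnWith K (fun x => r x - x) (Metric.closedBall 0 1) :=
    (hr.sub contDiff_id).contDiffOn.exists_lipschitzOnWith one_ne_zero
      (convex_closedBall 0 1) (isCompact_closedBall 0 1)
  have hgK : LipschitzWith K g := by
    refine lipschitzWith_of_eq_zero_outside_closedBall (fun x hx y hy => ?_) hg0
    simpa [g, mem_closedBall_zero_iff.1 hx, mem_closedBall_zero_iff.1 hy] using hK hx hy
  have hgA : ∀ x ∈ B, HasFDerivAt g (A x) x := by
    intro x hx
    have h1 : HasFDerivAt (fun x => r x - x) (A x) x :=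
      ((hr.differentiable one_ne_zero) x).hasFDerivAt.sub (hasFDerivAt_id x)
    refine h1.congr_of_eventuallyEq ?_
    filter_upwards [Metric.isOpen_ball.mem_nhds hx] with y hy
    simp [g, (mem_ball_zero_iff.1 hy).le]
  obtain ⟨C, hC⟩ : ∃ C, ∀ x ∈ Metric.closedBall (0 : E) 1, ‖A x‖ ≤ C :=
    (isCompact_closedBall 0 1).exists_bound_of_continuousOn hA.continuousOn
  have hdetc : Continuous (fun T : E →L[ℝ] E => T.det) := ContinuousLinearMap.continuous_det
  obtain ⟨δ, hδ, hpos⟩ : ∃ δ > 0, ∀ T : E →L[ℝ] E, ‖T‖ < δ → 0 < (1 + T).det := by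
    have : ∀ᶠ T : E →L[ℝ] E in 𝓝 0, 0 < (1 + T).det := by
      have hc : Continuous (fun T : E →L[ℝ] E => (1 + T).det) :=
        hdetc.comp (continuous_const.add continuous_id)
      refine (hc.tendsto 0).eventually (lt_mem_nhds ?_)
      simp [ContinuousLinearMap.det]
    obtain ⟨δ, hδ, h⟩ := Metric.eventually_nhds_iff.1 this
    exact ⟨δ, hδ, fun T hT => h (by simpa using hT)⟩
  -- The first bound makes `t • g` a contraction; the second makes the Jacobian positive, so the
  -- absolute value in the change of variables disappears.
  obtain ⟨τ, hτ, hτK, hτC⟩ : ∃ τ : ℝ, 0 < τ ∧ τ * K < 1 ∧ τ * (|C| + 1) < δ := by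
    have h1 : ∀ᶠ τ : ℝ in 𝓝[>] 0, τ * K < 1 := by
      exact nhdsWithin_le_nhds (((continuous_id.mul continuous_const).tendsto' 0 0
        (by simp)).eventually (gt_mem_nhds one_pos))
    have h2 : ∀ᶠ τ : ℝ in 𝓝[>] 0, τ * (|C| + 1) < δ := by
      exact nhdsWithin_le_nhds (((continuous_id.mul continuous_const).tendsto' 0 0
        (by simp)).eventually (gt_mem_nhds hδ))
    obtain ⟨τ, ⟨h1, h2⟩, h3⟩ := ((h1.and h2).and self_mem_nhdsWithin).exists
    exact ⟨τ, h3, h1, h2⟩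
  have hint : ∀ t : ℝ, 0 < t → t ≤ τ →
      IntegrableOn (fun x => (1 + t • A x).det) B μ ∧
        ∫ x in B, (1 + t • A x).det ∂μ = μ.real B := by
    intro t ht htτ
    have hdpos : ∀ x ∈ B, 0 < (1 + t • A x).det := by
      intro x hx
      apply hpos
      rw [norm_smul, Real.norm_of_nonneg ht.le]
      refine lt_of_le_of_lt ?_ hτC
      refine mul_le_mul htτ ?_ (norm_nonneg _) hτ.le
      linarith [hC x (Metric.ball_subset_closedBall hx), le_abs_self C]
    have hL : LipschitzWith (t.toNNReal * K) (fun x => t • g x) := by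
      refine LipschitzWith.of_dist_le_mul fun x y => ?_
      rw [dist_smul₀, Real.norm_of_nonneg ht.le, NNReal.coe_mul, Real.coe_toNNReal _ ht.le,
        mul_assoc]
      exact mul_le_mul_of_nonneg_left (hgK.dist_le_mul x y) ht.le
    obtain ⟨hinj, himg⟩ := injOn_image_ball_id_add hL
      (by
        rw [← NNReal.coe_lt_coe, NNReal.coe_mul, Real.coe_toNNReal _ ht.le]
        exact (mul_le_mul_of_nonneg_right htτ K.2).trans_lt hτK)
      (fun x hx => by rw [hg0 x hx, smul_zero])
    have hder : ∀ x ∈ B, HasFDerivWithinAt (fun x => x + t • g x) (1 + t • A x) B x :=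
      fun x hx => ((hasFDerivAt_id x).add ((hgA x hx).const_smul t)).hasFDerivWithinAt
    have hcongr : Set.EqOn (fun x => |(1 + t • A x).det| • (1 : ℝ))
        (fun x => (1 + t • A x).det) B := by
      intro x hx
      simp [abs_of_pos (hdpos x hx)]
    have hmB : MeasurableSet B := Metric.isOpen_ball.measurableSet
    constructor
    · rw [← integrableOn_congr_fun hcongr hmB,
        ← integrableOn_image_iff_integrableOn_abs_det_fderiv_smul μ hmB hder hinj.injOn
          (fun _ => (1 : ℝ)), himg]
      exact integrableOn_const Metric.isBounded_ball.measure_lt_top.ne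
    · rw [← setIntegral_congr_fun hmB hcongr,
        ← integral_image_eq_integral_abs_det_fderiv_smul μ hmB hder hinj.injOn
          (fun _ => (1 : ℝ)), himg]
      simp
      rfl
  -- The determinant has degree at most `finrank ℝ E` in `t`, so one more node than that, all in
  -- `(0, τ]`, recovers its value at 1.
  let N := Module.finrank ℝ E + 1
  let t : Fin N → ℝ := fun i => τ / ((i : ℕ) + 1)
  have htinj : Function.Injective t := by
    intro i j hij
    simp only [t] at hij
    field_simp at hij
    exact Fin.ext (by exact_mod_cast (add_right_cancel hij).symm)
  have ht0 : ∀ i, 0 < t i := fun i => by positivity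
  have htτ : ∀ i, t i ≤ τ := fun i => div_le_self hτ.le (by simp)
  obtain ⟨c, hc1, hc⟩ := exists_det_one_add_eq_sum E (Nat.lt_succ_self _) htinj
  have hzero : ∀ x ∈ B, (1 + A x).det = 0 := by
    intro x hx
    have : 1 + A x = fderiv ℝ r x := add_sub_cancel _ _
    rw [this]
    refine det_eq_zero_of_hasFDerivAt_of_norm_eq_one ((hr.differentiable one_ne_zero) x).hasFDerivAt ?_
    filter_upwards [Metric.isOpen_ball.mem_nhds hx] with y hy
    exact hn y (mem_ball_zero_iff.1 hy).le
  have h1 : ∫ x in B, (1 + A x).det ∂μ = 0 := by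
    rw [setIntegral_congr_fun Metric.isOpen_ball.measurableSet hzero]; simp
  rw [setIntegral_congr_fun Metric.isOpen_ball.measurableSet fun x _ => hc (A x),
    integral_finsetSum _ fun i _ => ((hint (t i) (ht0 i) (htτ i)).1.const_mul _)] at h1
  simp_rw [integral_const_mul, fun i => (hint (t i) (ht0 i) (htτ i)).2] at h1
  rw [← Finset.sum_mul, hc1, one_mul] at h1
  have : 0 < μ B := Metric.measure_ball_pos μ 0 one_pos
  rw [measureReal_def, ENNReal.toReal_eq_zero_iff] at h1
  rcases h1 with h1 | h1
  · exact this.ne' h1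
  · exact Metric.isBounded_ball.measure_lt_top.ne h1

/-! ### Continuous injections cannot lower dimension. -/

theorem contDiff_eval {ι : Type*} [Fintype ι] (q : MvPolynomial ι ℝ) :
    ContDiff ℝ 1 fun y : ι → ℝ => MvPolynomial.eval y q := by
  induction q using MvPolynomial.induction_on with
  | C a => simpa using contDiff_const
  | add p q hp hq => simpa using hp.add hq
  | mul_X p i hp => simpa using hp.mul (contDiff_apply ℝ ℝ i)

/-- On a compact set, a continuous map can be uniformly approximated by smooth functions of
any given continuous injection. -/
theorem exists_contDiff_comp_near {E ι κ : Type*} [TopologicalSpace E] [Fintype ι] [Fintype κ]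
    {S : Set E}
    (hS : IsCompact S) {f : E → ι → ℝ} (hf : ContinuousOn f S) (hinj : Set.InjOn f S)
    {h : E → EuclideanSpace ℝ κ} (hh : ContinuousOn h S) {ε : ℝ} (hε : 0 < ε) :
    ∃ p : (ι → ℝ) → EuclideanSpace ℝ κ, ContDiff ℝ 1 p ∧ ∀ x ∈ S, ‖p (f x) - h x‖ < ε := by
  have : CompactSpace S := isCompact_iff_compactSpace.1 hS
  have real : ∀ (h : E → ℝ), ContinuousOn h S → ∀ δ > 0,
      ∃ p : (ι → ℝ) → ℝ, ContDiff ℝ 1 p ∧ ∀ x ∈ S, ‖p (f x) - h x‖ < δ := by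
    intro h hh δ hδ
    let F : ι → C(S, ℝ) := fun i =>
      ⟨fun x => f x i, (continuous_apply i).comp hf.domRestrict⟩
    -- Polynomials in the coordinates of `f` separate points because `f` is injective, so
    -- Stone–Weierstrass applies.
    let 𝒜 : Subalgebra ℝ C(S, ℝ) := (MvPolynomial.aeval F).range
    have hsep : 𝒜.SeparatesPoints := by
      intro x y hxy
      have : f x ≠ f y := fun h => hxy (Subtype.ext (hinj x.2 y.2 h))
      obtain ⟨i, hi⟩ := Function.ne_iff.1 this
      exact ⟨F i, ⟨F i, ⟨MvPolynomial.X i, by simp⟩, rfl⟩, hi⟩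
    obtain ⟨⟨_, q, rfl⟩, hq⟩ :=
      ContinuousMap.exists_mem_subalgebra_near_continuous_of_separatesPoints 𝒜 hsep
        (S.domRestrict h) hh.domRestrict δ hδ
    refine ⟨fun y => MvPolynomial.eval y q, contDiff_eval q, fun x hx => ?_⟩
    have h1 : ∀ q : MvPolynomial ι ℝ,
        MvPolynomial.aeval F q ⟨x, hx⟩ = MvPolynomial.eval (f x) q := by
      intro q
      induction q using MvPolynomial.induction_on with
      | C a => simp
      | add p q hp hq => simp [hp, hq]
      | mul_X p i hp => simp [hp, F]
    have h2 := hq ⟨x, hx⟩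
    simp only [← h1]
    exact h2
  let e := (EuclideanSpace.equiv κ ℝ).symm
  -- This constant converts sup-norm errors into Euclidean ones; the added 1 keeps it positive.
  let C := ‖(e : (κ → ℝ) →L[ℝ] EuclideanSpace ℝ κ)‖ + 1
  have hC : 0 < C := by positivity
  choose p hp hpε using fun k => real (fun x => h x k)
    ((EuclideanSpace.proj k : EuclideanSpace ℝ κ →L[ℝ] ℝ).continuous.comp_continuousOn hh)
    (ε / C) (by positivity)
  refine ⟨fun y => e (fun k => p k y), e.contDiff.comp (contDiff_pi.2 hp), fun x hx => ?_⟩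
  have h1 : e (fun k => p k (f x)) - h x = e (fun k => p k (f x) - h x k) := by
    ext k; simp [e]
  have h2 : ‖fun k => p k (f x) - h x k‖ < ε / C :=
    (pi_norm_lt_iff (by positivity)).2 fun k => hpε k x hx
  rw [h1]
  calc ‖e (fun k => p k (f x) - h x k)‖
      ≤ ‖(e : (κ → ℝ) →L[ℝ] EuclideanSpace ℝ κ)‖ * ‖fun k => p k (f x) - h x k‖ :=
        (e : (κ → ℝ) →L[ℝ] EuclideanSpace ℝ κ).le_opNorm _
    _ ≤ C * ‖fun k => p k (f x) - h x k‖ := by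
        gcongr; simp [C]
    _ < C * (ε / C) := by gcongr
    _ = ε := by field_simp

/-- The cutoff `χ` glues `h` on the ball of radius 1/2 to the identity outside the unit ball. In the
shell between, the correction has norm below `1 / 2 < ‖x‖`, so no zero appears there. Without a zero
of `h`, normalizing `k` would give a retraction onto the sphere. -/
theorem exists_zero_of_contDiff_near_id {E : Type*} [NormedAddCommGroup E]
    [InnerProductSpace ℝ E] [FiniteDimensional ℝ E] {h : E → E} (hh : ContDiff ℝ 1 h)
    (hid : ∀ x, ‖x‖ ≤ 1 → ‖h x - x‖ < 1 / 2) : ∃ x, ‖x‖ ≤ 1 ∧ h x = 0 := by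
  by_contra! hne
  let χ : ContDiffBump (0 : E) := ⟨1 / 2, 1, by norm_num, by norm_num⟩
  let k : E → E := fun x => x + χ x • (h x - x)
  have hk : ContDiff ℝ 1 k := contDiff_id.add (χ.contDiff.smul (hh.sub contDiff_id))
  have hout : ∀ x, 1 ≤ ‖x‖ → k x = x := by
    intro x hx
    have : χ x = 0 := χ.zero_of_le_dist (by simpa using hx)
    simp [k, this]
  have hk0 : ∀ x, k x ≠ 0 := by
    intro x
    rcases le_or_gt ‖x‖ (1 / 2) with hx | hx
    · have : χ x = 1 := χ.one_of_mem_closedBall (by simpa [χ] using hx)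
      simpa [k, this] using hne x (by linarith)
    rcases le_or_gt ‖x‖ 1 with hx1 | hx1
    · intro h0
      have h2 : ‖χ x • (h x - x)‖ < 1 / 2 := by
        rw [norm_smul, Real.norm_of_nonneg χ.nonneg]
        exact (mul_le_of_le_one_left (norm_nonneg _) χ.le_one).trans_lt (hid x hx1)
      have h3 : χ x • (h x - x) = -x := by
        rw [eq_neg_iff_add_eq_zero, add_comm]; exact h0
      rw [h3, norm_neg] at h2
      linarith
    · rw [hout x hx1.le]
      intro h0
      simp [h0] at hx
      linarith
  refine not_contDiff_retraction (r := fun x => ‖k x‖⁻¹ • k x)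
    (((hk.norm ℝ hk0).inv fun x => norm_ne_zero_iff.2 (hk0 x)).smul hk) ?_ ?_
  · intro x _
    rw [norm_smul, norm_inv, norm_norm, inv_mul_cancel₀ (norm_ne_zero_iff.2 (hk0 x))]
  · intro x hx
    simp [hout x hx.ge, hx]

/-- By compactness, a zero-free `h` is bounded away from 0, so a close enough `C¹` approximation
would be zero-free too, while staying within 1/2 of the identity. -/
theorem exists_zero_of_continuousOn_near_id {κ : Type*} [Fintype κ]
    {h : EuclideanSpace ℝ κ → EuclideanSpace ℝ κ}
    (hh : ContinuousOn h (Metric.closedBall 0 1))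
    (hid : ∀ x, ‖x‖ ≤ 1 → ‖h x - x‖ < 1 / 4) : ∃ x, ‖x‖ ≤ 1 ∧ h x = 0 := by
  have hcomp : IsCompact (Metric.closedBall (0 : EuclideanSpace ℝ κ) 1) :=
    isCompact_closedBall 0 1
  by_contra! hne
  obtain ⟨x₀, hx₀, hmin⟩ := hcomp.exists_isMinOn ⟨0, by simp⟩ hh.norm
  have hδ : 0 < ‖h x₀‖ := norm_pos_iff.2 (hne x₀ (by simpa using hx₀))
  obtain ⟨p, hp, hpε⟩ := exists_contDiff_comp_near hcomp
    (f := EuclideanSpace.equiv κ ℝ) (EuclideanSpace.equiv κ ℝ).continuous.continuousOn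
    (EuclideanSpace.equiv κ ℝ).injective.injOn hh
    (lt_min hδ (show (0 : ℝ) < 1 / 4 by norm_num))
  obtain ⟨x, hx, hx0⟩ := exists_zero_of_contDiff_near_id
    (h := fun x => p (EuclideanSpace.equiv κ ℝ x))
    (hp.comp (EuclideanSpace.equiv κ ℝ).contDiff) (by
      intro x hx
      have h1 := (hpε x (by simpa using hx)).trans_le (min_le_right _ _)
      have h2 := hid x hx
      have h3 := norm_sub_le_norm_sub_add_norm_sub (p (EuclideanSpace.equiv κ ℝ x)) (h x) x
      linarith)
  have h1 := (hpε x (by simpa using hx)).trans_le (min_le_left _ _)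
  rw [hx0, zero_sub, norm_neg] at h1
  exact absurd (hmin (show x ∈ _ by simpa using hx)) (not_le.2 h1)

/-- There is no continuous injection of a nonempty open set of a Euclidean space into a space of
smaller dimension. -/
theorem not_injOn_of_continuousOn_of_card_lt {κ ι : Type*} [Fintype κ] [Fintype ι]
    (hcard : Fintype.card ι < Fintype.card κ) {f : EuclideanSpace ℝ κ → ι → ℝ}
    {U : Set (EuclideanSpace ℝ κ)} (hU : IsOpen U) (hne : U.Nonempty) (hf : ContinuousOn f U) :
    ¬ Set.InjOn f U := by
  intro hinj
  obtain ⟨a, ha⟩ := hne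
  obtain ⟨ρ, hρ, hball⟩ := Metric.nhds_basis_closedBall.mem_iff.1 (hU.mem_nhds ha)
  let φ : EuclideanSpace ℝ κ → EuclideanSpace ℝ κ := fun x => a + ρ • x
  have hφ : Set.MapsTo φ (Metric.closedBall 0 1) U := by
    intro x hx
    apply hball
    simp only [φ, Metric.mem_closedBall, dist_self_add_left, norm_smul,
      Real.norm_of_nonneg hρ.le]
    exact mul_le_of_le_one_right hρ.le (by simpa using hx)
  have hφinj : Function.Injective φ :=
    (add_right_injective a).comp (smul_right_injective _ hρ.ne')
  have hφc : Continuous φ := by fun_prop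
  have hfφ : ContinuousOn (f ∘ φ) (Metric.closedBall 0 1) := hf.comp hφc.continuousOn hφ
  -- `p` is an approximate left inverse of `f ∘ φ`. The errors 1/8 from `p` and 1/8 from `c` add up
  -- to the allowed 1/4.
  obtain ⟨p, hp, hpε⟩ := exists_contDiff_comp_near (isCompact_closedBall 0 1) hfφ
    (hinj.comp hφinj.injOn hφ) (h := id) continuousOn_id (show (0 : ℝ) < 1 / 8 by norm_num)
  have hdense := hp.dense_compl_range_of_finrank_lt_finrank (by simpa using hcard)
  obtain ⟨c, hc, hc0⟩ := hdense.exists_dist_lt 0 (show (0 : ℝ) < 1 / 8 by norm_num)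
  rw [dist_zero_left] at hc0
  obtain ⟨x, -, hx0⟩ := exists_zero_of_continuousOn_near_id
    (h := fun x => p (f (φ x)) - c)
    ((hp.continuous.comp_continuousOn hfφ).sub continuousOn_const) (by
      intro x hx
      have h1 := hpε x (by simpa using hx)
      have h2 : p (f (φ x)) - c - x = (p ((f ∘ φ) x) - id x) - c := by
        simp only [Function.comp, id]; abel
      rw [h2]
      linarith [norm_sub_le (p ((f ∘ φ) x) - id x) c])
  exact hc ⟨_, sub_eq_zero.1 hx0⟩

/-! ### Differential calculus within `Θ`. -/

section Calculus

variable {D : ℕ} {Θ : Set (EuclideanSpace ℝ (Fin D))} {θ : EuclideanSpace ℝ (Fin D)}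

theorem TwiceDifferentiableOn.differentiableOn {f : EuclideanSpace ℝ (Fin D) → ℝ}
    (hf : TwiceDifferentiableOn f Θ) : DifferentiableOn ℝ f Θ :=
  let ⟨_, h, _⟩ := hf
  fun θ hθ => (h θ hθ).differentiableWithinAt

theorem TwiceDifferentiableOn.congr {f g : EuclideanSpace ℝ (Fin D) → ℝ}
    (hf : TwiceDifferentiableOn f Θ) (h : Set.EqOn g f Θ) : TwiceDifferentiableOn g Θ :=
  let ⟨f', h1, h2⟩ := hf
  ⟨f', fun θ hθ => (h1 θ hθ).congr h (h hθ), h2⟩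

theorem twiceDifferentiableOn_const (c : ℝ) : TwiceDifferentiableOn (fun _ => c) Θ :=
  ⟨fun _ => 0, fun θ _ => hasFDerivWithinAt_const c θ Θ, differentiableOn_const _⟩

theorem TwiceDifferentiableOn.mul {f g : EuclideanSpace ℝ (Fin D) → ℝ}
    (hf : TwiceDifferentiableOn f Θ) (hg : TwiceDifferentiableOn g Θ) :
    TwiceDifferentiableOn (fun θ => f θ * g θ) Θ :=
  let ⟨f', hf1, hf2⟩ := hf
  let ⟨g', hg1, hg2⟩ := hg
  ⟨fun θ => f θ • g' θ + g θ • f' θ, fun θ hθ => (hf1 θ hθ).mul (hg1 θ hθ),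
    (hf.differentiableOn.smul hg2).add (hg.differentiableOn.smul hf2)⟩

theorem TwiceDifferentiableOn.prod {ι : Type*} (s : Finset ι)
    {f : ι → EuclideanSpace ℝ (Fin D) → ℝ} (hf : ∀ i, TwiceDifferentiableOn (f i) Θ) :
    TwiceDifferentiableOn (fun θ => ∏ i ∈ s, f i θ) Θ := by
  classical
  induction s using Finset.induction_on with
  | empty => simpa using twiceDifferentiableOn_const 1
  | insert i s hi ih =>
    simp only [Finset.prod_insert hi]
    exact (hf i).mul ih

theorem TwiceDifferentiableOn.differentiableWithinAt_partialOn
    {f : EuclideanSpace ℝ (Fin D) → ℝ} (hf : TwiceDifferentiableOn f Θ) (hθ : θ ∈ Θ)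
    (hu : ∀ᶠ η in 𝓝[Θ] θ, UniqueDiffWithinAt ℝ Θ η) (b : Fin D) :
    DifferentiableWithinAt ℝ (partialOn Θ b f) Θ θ := by
  obtain ⟨f', h1, h2⟩ := hf
  have h3 : DifferentiableWithinAt ℝ (fun η => f' η (EuclideanSpace.single b 1)) Θ θ :=
    (h2 θ hθ).clm_apply (differentiableWithinAt_const _)
  have heq : partialOn Θ b f =ᶠ[𝓝[Θ] θ] fun η => f' η (EuclideanSpace.single b 1) := by
    filter_upwards [hu, self_mem_nhdsWithin] with η hη hηΘ
    rw [partialOn, (h1 η hηΘ).fderivWithin hη]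
  exact h3.congr_of_eventuallyEq heq (heq.self_of_nhdsWithin hθ)

theorem partialOn_congr {f g : EuclideanSpace ℝ (Fin D) → ℝ} (h : f =ᶠ[𝓝[Θ] θ] g) (hθ : θ ∈ Θ)
    (a : Fin D) : partialOn Θ a f θ = partialOn Θ a g θ := by
  rw [partialOn, partialOn, h.fderivWithin_eq (h.self_of_nhdsWithin hθ)]

theorem partialOn_const (c : ℝ) (a : Fin D) : partialOn Θ a (fun _ => c) θ = 0 := by
  simp [partialOn]

theorem partialOn_sum {ι : Type*} [Fintype ι] {f : ι → EuclideanSpace ℝ (Fin D) → ℝ}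
    (hu : UniqueDiffWithinAt ℝ Θ θ) (hf : ∀ i, DifferentiableWithinAt ℝ (f i) Θ θ) (a : Fin D) :
    partialOn Θ a (fun η => ∑ i, f i η) θ = ∑ i, partialOn Θ a (f i) θ := by
  simp only [partialOn]
  rw [fderivWithin_fun_sum hu fun i _ => hf i, sum_apply]

/-- Where `f θ = 0`, the left side and `1 / f θ` are zero by convention, so the identity needs the
second derivative of `f` to vanish; `h0` ensures this. -/
theorem mul_partialOn_partialOn_log {f : EuclideanSpace ℝ (Fin D) → ℝ}
    (hf : TwiceDifferentiableOn f Θ) (hθ : θ ∈ Θ)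
    (hu : ∀ᶠ η in 𝓝[Θ] θ, UniqueDiffWithinAt ℝ Θ η)
    (h0 : f θ = 0 → ∀ᶠ η in 𝓝[Θ] θ, f η = 0) (a b : Fin D) :
    f θ * partialOn Θ a (partialOn Θ b fun η => Real.log (f η)) θ =
      partialOn Θ a (partialOn Θ b f) θ -
        1 / f θ * (partialOn Θ a f θ * partialOn Θ b f θ) := by
  have huθ := hu.self_of_nhdsWithin hθ
  by_cases hfθ : f θ = 0
  · have h1 : partialOn Θ b f =ᶠ[𝓝[Θ] θ] fun _ => 0 := by
      filter_upwards [eventually_eventually_nhdsWithin.2 (h0 hfθ), self_mem_nhdsWithin]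
        with η hη hηΘ
      rw [partialOn_congr (g := fun _ => 0) hη hηΘ, partialOn_const]
    rw [partialOn_congr h1 hθ, partialOn_const, hfθ]
    simp
  · have hne : ∀ᶠ η in 𝓝[Θ] θ, f η ≠ 0 :=
      (hf.differentiableOn θ hθ).continuousWithinAt.eventually_ne hfθ
    have h1 : (partialOn Θ b fun η => Real.log (f η)) =ᶠ[𝓝[Θ] θ]
        fun η => (f η)⁻¹ * partialOn Θ b f η := by
      filter_upwards [hne, hu, self_mem_nhdsWithin] with η hη hηu hηΘ
      rw [partialOn, fderivWithin.log (hf.differentiableOn η hηΘ) hη hηu]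
      simp [partialOn]
    have h2 := ((hasDerivAt_inv hfθ).comp_hasFDerivWithinAt θ
      (hf.differentiableOn θ hθ).hasFDerivWithinAt).mul
      (hf.differentiableWithinAt_partialOn hθ hu b).hasFDerivWithinAt
    have h3 : partialOn Θ a (fun η => (f η)⁻¹ * partialOn Θ b f η) θ =
        (f θ)⁻¹ * partialOn Θ a (partialOn Θ b f) θ +
          partialOn Θ b f θ * (-(f θ ^ 2)⁻¹ * partialOn Θ a f θ) :=
      DFunLike.congr_fun (h2.fderivWithin huθ) (EuclideanSpace.single a 1)
    rw [partialOn_congr h1 hθ, h3]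
    field_simp
    ring

theorem sum_partialOn_partialOn_eq_zero {ι : Type*} [Fintype ι]
    {f : ι → EuclideanSpace ℝ (Fin D) → ℝ} (hf : ∀ i, TwiceDifferentiableOn (f i) Θ)
    (hθ : θ ∈ Θ) (hu : ∀ᶠ η in 𝓝[Θ] θ, UniqueDiffWithinAt ℝ Θ η)
    (hsum : ∀ η ∈ Θ, ∑ i, f i η = 1) (a b : Fin D) :
    ∑ i, partialOn Θ a (partialOn Θ b (f i)) θ = 0 := by
  rw [← partialOn_sum (hu.self_of_nhdsWithin hθ)
    fun i => (hf i).differentiableWithinAt_partialOn hθ hu b]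
  have : (fun η => ∑ i, partialOn Θ b (f i) η) =ᶠ[𝓝[Θ] θ] fun _ => 0 := by
    filter_upwards [hu, self_mem_nhdsWithin] with η hη hηΘ
    rw [← partialOn_sum hη fun i => (hf i).differentiableOn η hηΘ,
      partialOn_congr (g := fun _ => 1) (Filter.eventually_of_mem self_mem_nhdsWithin hsum) hηΘ,
      partialOn_const]
  rw [partialOn_congr this hθ, partialOn_const]

theorem fderivWithin_prod_apply_eq_zero {ι : Type*} [Fintype ι]
    {f : EuclideanSpace ℝ (Fin D) → ℝ} {g : ι → EuclideanSpace ℝ (Fin D) → ℝ}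
    (hfg : Set.EqOn f (fun η => ∏ i, g i η) Θ) (hθ : θ ∈ Θ) (hu : UniqueDiffWithinAt ℝ Θ θ)
    (hg : ∀ i, DifferentiableWithinAt ℝ (g i) Θ θ) {v : EuclideanSpace ℝ (Fin D)}
    (hv : ∀ i, fderivWithin ℝ (g i) Θ θ v = 0) : fderivWithin ℝ f Θ θ v = 0 := by
  classical
  rw [fderivWithin_congr hfg (hfg hθ),
    (HasFDerivWithinAt.finsetProd fun i _ => (hg i).hasFDerivWithinAt).fderivWithin hu]
  simp [hv]

/-- Each rank-one summand annihilates the coordinate vector of `v`. -/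
theorem det_sum_rankOne_eq_zero {κ : Type*} [Fintype κ] (c : κ → ℝ)
    (φ : κ → EuclideanSpace ℝ (Fin D) →L[ℝ] ℝ) {v : EuclideanSpace ℝ (Fin D)} (hv : v ≠ 0)
    (hφ : ∀ k, φ k v = 0) :
    (Matrix.of fun a b => ∑ k, c k *
      (φ k (EuclideanSpace.single a 1) * φ k (EuclideanSpace.single b 1))).det = 0 := by
  have hφv : ∀ k, ∑ b, φ k (EuclideanSpace.single b 1) * v b = 0 := by
    intro k
    rw [← hφ k]
    conv_rhs => rw [← (EuclideanSpace.basisFun (Fin D) ℝ).sum_repr v]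
    simp [mul_comm]
  rw [← Matrix.exists_mulVec_eq_zero_iff]
  refine ⟨v, fun h => hv (by ext i; exact congrFun h i), ?_⟩
  ext a
  simp only [Matrix.mulVec, dotProduct, Matrix.of_apply, Pi.zero_apply, Finset.sum_mul]
  rw [Finset.sum_comm]
  refine Finset.sum_eq_zero fun k _ => ?_
  rw [← mul_zero (c k * φ k (EuclideanSpace.single a 1)), ← hφv k, Finset.mul_sum]
  exact Finset.sum_congr rfl fun b _ => by ring

end Calculus

/-! ### Factorization and marginals of the quantized law. -/

theorem VectorQuantizer.quantize_eq_iff {X : Type*} [MeasurableSpace X] {R : ℕ}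
    (γ : VectorQuantizer X R) (y : X) (r : Fin R) :
    γ.quantize y = (r : ℕ) + 1 ↔ y ∈ γ.region r := by
  have key : ∀ r, y ∈ γ.region r → γ.quantize y = (r : ℕ) + 1 := by
    intro r hr
    rw [VectorQuantizer.quantize, Finset.sum_eq_single r]
    · simp [hr]
    · intro r' _ hne
      exact Set.indicator_of_notMem
        (fun h => (Set.disjoint_left.1 (γ.disjoint_region hne) h) hr) _
    · simp
  refine ⟨fun h => ?_, key r⟩
  obtain ⟨r', hr'⟩ := Set.mem_iUnion.1 (γ.cover ▸ Set.mem_univ y : y ∈ ⋃ r, γ.region r)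
  have : r' = r := Fin.ext (by have := key r' hr'; omega)
  exact this ▸ hr'

section System

variable {N D : ℕ} {L : Fin N → ℕ} {R : ∀ j, Fin (L j) → ℕ}
  {X : ∀ j, Fin (L j) → Type*} [∀ j l, MeasurableSpace (X j l)]
  {Ω : Type*} [MeasurableSpace Ω]
  {γ : ∀ j l, VectorQuantizer (X j l) (R j l)} {x : ∀ j l, Ω → X j l}
  {P : EuclideanSpace ℝ (Fin D) → Measure Ω}
  {Θ : Set (EuclideanSpace ℝ (Fin D))} {θ : EuclideanSpace ℝ (Fin D)}

/-- The probability that subvector `l` of sensor `j` falls into region `r`. -/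
def levelProb (γ : ∀ j l, VectorQuantizer (X j l) (R j l)) (x : ∀ j l, Ω → X j l)
    (P : EuclideanSpace ℝ (Fin D) → Measure Ω) (j : Fin N) (l : Fin (L j)) (r : Fin (R j l))
    (θ : EuclideanSpace ℝ (Fin D)) : ℝ :=
  (P θ).real (x j l ⁻¹' (γ j l).region r)

theorem superquantize_eq_iff {j : Fin N} {y : ∀ l, X j l} {s : Outcome R j} :
    (superquantize γ j y = fun l => (s l : ℕ) + 1) ↔ ∀ l, y l ∈ (γ j l).region (s l) := by
  simp only [funext_iff, superquantize, VectorQuantizer.quantize_eq_iff]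

theorem sum_levelProb (hx : ∀ j l, Measurable (x j l)) [IsProbabilityMeasure (P θ)] (j : Fin N)
    (l : Fin (L j)) : ∑ r, levelProb γ x P j l r θ = 1 := by
  simp only [levelProb]
  rw [← measureReal_iUnion_fintype
    (fun r r' h => ((γ j l).disjoint_region h).preimage _)
    (fun r => hx j l ((γ j l).measurableSet_region r)), ← Set.preimage_iUnion, (γ j l).cover]
  simp

theorem outcomeProb_eq_prod
    (hindep : iIndepFun (fun (i : Σ j : Fin N, Fin (L j)) => x i.1 i.2) (P θ))
    (j : Fin N) (s : Outcome R j) :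
    outcomeProb γ x P j s θ = ∏ l, levelProb γ x P j l (s l) θ := by
  have h := (hindep.precomp (sigma_mk_injective (i := j))).meas_iInter
    (s := fun l => x j l ⁻¹' (γ j l).region (s l))
    (fun l => ⟨_, (γ j l).measurableSet_region (s l), rfl⟩)
  simp only [outcomeProb, levelProb, superquantize_eq_iff, measureReal_def, Set.ofPred_forall]
  rw [← ENNReal.toReal_prod, ← h]
  rfl

theorem dataProb_eq_prod
    (hindep : iIndepFun (fun (i : Σ j : Fin N, Fin (L j)) => x i.1 i.2) (P θ))
    (u : ∀ j, Outcome R j) : dataProb γ x P u θ = ∏ j, outcomeProb γ x P j (u j) θ := by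
  have h := hindep.meas_iInter
    (s := fun i => x i.1 i.2 ⁻¹' (γ i.1 i.2).region (u i.1 i.2))
    (fun i => ⟨_, (γ i.1 i.2).measurableSet_region (u i.1 i.2), rfl⟩)
  simp only [outcomeProb_eq_prod hindep]
  rw [← Fintype.prod_sigma' (fun j l => levelProb γ x P j l (u j l) θ)]
  simp only [dataProb, levelProb, superquantize_eq_iff, measureReal_def, Set.ofPred_forall]
  rw [← ENNReal.toReal_prod, ← h, Set.iInter_sigma]
  rfl

/-- Regularity is assumed only for `outcomeProb`; writing a level probability as a marginal
transfers it. -/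
theorem levelProb_eq_sum (hx : ∀ j l, Measurable (x j l)) [IsProbabilityMeasure (P θ)]
    (hindep : iIndepFun (fun (i : Σ j : Fin N, Fin (L j)) => x i.1 i.2) (P θ))
    (j : Fin N) (l : Fin (L j)) (r : Fin (R j l)) :
    levelProb γ x P j l r θ = ∑ s : Outcome R j with s l = r, outcomeProb γ x P j s θ := by
  classical
  -- The outcomes with `s l = r` form a box: `{r}` in coordinate `l`, everything elsewhere. The
  -- other factors then sum to 1.
  let t : ∀ l' : Fin (L j), Finset (Fin (R j l')) := fun l' =>
    Finset.univ.filter fun r' => ∀ h : l' = l, h ▸ r' = r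
  have ht : (Finset.univ.filter fun s : Outcome R j => s l = r) = Fintype.piFinset t := by
    ext s
    simp only [Finset.mem_filter, Finset.mem_univ, true_and, Fintype.mem_piFinset, t]
    exact ⟨fun h l' hl => by subst hl; exact h, fun h => h l rfl⟩
  simp only [outcomeProb_eq_prod hindep]
  rw [ht, ← Finset.prod_univ_sum t fun l r => levelProb γ x P j l r θ, Finset.prod_eq_single l]
  · have : t l = {r} := by ext r'; simp [t]
    rw [this, Finset.sum_singleton]
  · intro l' _ hne
    have : t l' = Finset.univ := by ext r'; simp [t, hne]
    rw [this, sum_levelProb hx]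
  · simp

theorem sum_dataProb (hx : ∀ j l, Measurable (x j l)) [IsProbabilityMeasure (P θ)]
    (hindep : iIndepFun (fun (i : Σ j : Fin N, Fin (L j)) => x i.1 i.2) (P θ)) :
    ∑ u : ∀ j, Outcome R j, dataProb γ x P u θ = 1 := by
  classical
  simp only [dataProb_eq_prod hindep, outcomeProb_eq_prod hindep]
  rw [← Fintype.piFinset_univ, ← Finset.prod_univ_sum (fun j => Finset.univ)
    (fun j (s : Outcome R j) => ∏ l, levelProb γ x P j l (s l) θ)]
  refine Finset.prod_eq_one fun j _ => ?_
  rw [← Fintype.piFinset_univ, ← Finset.prod_univ_sum (fun l => Finset.univ)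
    (fun l r => levelProb γ x P j l r θ)]
  exact Finset.prod_eq_one fun l _ => sum_levelProb hx j l

/-- The levels of all subvectors, without one reference level for each subvector. -/
abbrev FreeLevel (r₀ : ∀ j (l : Fin (L j)), Fin (R j l)) : Type :=
  Σ i : (Σ j : Fin N, Fin (L j)), {r : Fin (R i.1 i.2) // r ≠ r₀ i.1 i.2}

theorem card_freeLevel (r₀ : ∀ j (l : Fin (L j)), Fin (R j l)) :
    (Fintype.card (FreeLevel r₀) : ℤ) = lambdaIndep R := by
  have h : ∀ i : Σ j : Fin N, Fin (L j),
      (Fintype.card {r : Fin (R i.1 i.2) // r ≠ r₀ i.1 i.2} : ℤ) = R i.1 i.2 - 1 := by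
    intro i
    have : 0 < R i.1 i.2 := (r₀ i.1 i.2).pos
    rw [Fintype.card_subtype_compl, Fintype.card_fin, Fintype.card_unique]
    omega
  rw [Fintype.card_sigma, Nat.cast_sum, Finset.sum_congr rfl fun i _ => h i,
    Fintype.sum_sigma, lambdaIndep, ← Finset.sum_sub_distrib]
  simp

/-- A probability space is nonempty and the regions cover, so every quantizer has at least one
level. -/
theorem exists_referenceLevel (γ : ∀ j l, VectorQuantizer (X j l) (R j l))
    (x : ∀ j l, Ω → X j l) [IsProbabilityMeasure (P θ)] :
    Nonempty (∀ j (l : Fin (L j)), Fin (R j l)) := by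
  have : Nonempty Ω := nonempty_of_isProbabilityMeasure (P θ)
  obtain ⟨ω⟩ := this
  refine ⟨fun j l => Classical.choice ?_⟩
  obtain ⟨r, -⟩ := Set.mem_iUnion.1
    ((γ j l).cover ▸ Set.mem_univ (x j l ω) : x j l ω ∈ ⋃ r, (γ j l).region r)
  exact ⟨r⟩

/-! ### Singularity of the Fisher information. -/

theorem exists_fderivWithin_eq_zero (hx : ∀ j l, Measurable (x j l))
    (hP : ∀ θ ∈ Θ, IsProbabilityMeasure (P θ))
    (hindep : ∀ θ ∈ Θ, iIndepFun (fun (i : Σ j : Fin N, Fin (L j)) => x i.1 i.2) (P θ))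
    (hD : (D : ℤ) > lambdaIndep R) (hθ : θ ∈ Θ) (hu : UniqueDiffWithinAt ℝ Θ θ)
    (hd : ∀ j s, DifferentiableWithinAt ℝ (outcomeProb γ x P j s) Θ θ) :
    ∃ v ≠ 0, (∀ j s, fderivWithin ℝ (outcomeProb γ x P j s) Θ θ v = 0) ∧
      ∀ u, fderivWithin ℝ (dataProb γ x P u) Θ θ v = 0 := by
  classical
  have := hP θ hθ
  obtain ⟨r₀⟩ := exists_referenceLevel (P := P) (θ := θ) γ x
  have hl : ∀ j l r, DifferentiableWithinAt ℝ (levelProb γ x P j l r) Θ θ := by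
    intro j l r
    have h : DifferentiableWithinAt ℝ
        (fun η => ∑ s : Outcome R j with s l = r, outcomeProb γ x P j s η) Θ θ :=
      DifferentiableWithinAt.fun_sum fun s _ => hd j s
    refine h.congr (fun η hη => ?_) ?_
    · have := hP η hη
      exact levelProb_eq_sum hx (hindep η hη) j l r
    · exact levelProb_eq_sum hx (hindep θ hθ) j l r
  let T : EuclideanSpace ℝ (Fin D) →ₗ[ℝ] FreeLevel r₀ → ℝ :=
    LinearMap.pi fun i => (fderivWithin ℝ (levelProb γ x P i.1.1 i.1.2 i.2) Θ θ).toLinearMap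
  have hker : LinearMap.ker T ≠ ⊥ := by
    apply LinearMap.ker_ne_bot_of_finrank_lt
    have := card_freeLevel r₀
    simp only [Module.finrank_fintype_fun_eq_card, finrank_euclideanSpace_fin]
    omega
  obtain ⟨v, hv, hv0⟩ := Submodule.exists_mem_ne_zero_of_ne_bot hker
  have hfree : ∀ j l r, r ≠ r₀ j l → fderivWithin ℝ (levelProb γ x P j l r) Θ θ v = 0 :=
    fun j l r hr => congrFun (LinearMap.mem_ker.1 hv) ⟨⟨j, l⟩, ⟨r, hr⟩⟩
  have hall : ∀ j l r, fderivWithin ℝ (levelProb γ x P j l r) Θ θ v = 0 := by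
    intro j l r
    by_cases hr : r = r₀ j l
    -- The omitted reference level is handled by differentiating the constant sum of the level
    -- probabilities.
    · have h1 : fderivWithin ℝ (fun η => ∑ r, levelProb γ x P j l r η) Θ θ = 0 := by
        have h : Set.EqOn (fun η => ∑ r, levelProb γ x P j l r η) (fun _ => 1) Θ := by
          intro η hη
          have := hP η hη
          exact sum_levelProb hx j l
        rw [fderivWithin_congr h (h hθ), fderivWithin_const_apply]
      rw [fderivWithin_fun_sum hu fun r _ => hl j l r] at h1
      have h2 := DFunLike.congr_fun h1 v
      rw [sum_apply,
        Finset.sum_eq_single (r₀ j l) (fun r _ h => hfree j l r h) (by simp)] at h2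
      rw [hr, h2]; rfl
    · exact hfree j l r hr
  have hout : ∀ j s, fderivWithin ℝ (outcomeProb γ x P j s) Θ θ v = 0 := fun j s =>
    fderivWithin_prod_apply_eq_zero (fun η hη => outcomeProb_eq_prod (hindep η hη) j s) hθ hu
      (fun l => hl j l (s l)) fun l => hall j l (s l)
  exact ⟨v, hv0, hout, fun u =>
    fderivWithin_prod_apply_eq_zero (fun η hη => dataProb_eq_prod (hindep η hη) u) hθ hu
      (fun j => hd j (u j)) fun j => hout j (u j)⟩

theorem det_fisherGradient_eq_zero (hx : ∀ j l, Measurable (x j l))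
    (hP : ∀ θ ∈ Θ, IsProbabilityMeasure (P θ))
    (hindep : ∀ θ ∈ Θ, iIndepFun (fun (i : Σ j : Fin N, Fin (L j)) => x i.1 i.2) (P θ))
    (hD : (D : ℤ) > lambdaIndep R) (hθ : θ ∈ Θ) (hu : UniqueDiffWithinAt ℝ Θ θ)
    (hd : ∀ j s, DifferentiableWithinAt ℝ (outcomeProb γ x P j s) Θ θ) :
    (fisherGradient γ x P Θ θ).det = 0 := by
  obtain ⟨v, hv, hq, -⟩ := exists_fderivWithin_eq_zero hx hP hindep hD hθ hu hd
  rw [← det_sum_rankOne_eq_zero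
    (fun k : Σ j, Outcome R j => 1 / outcomeProb γ x P k.1 k.2 θ)
    (fun k => fderivWithin ℝ (outcomeProb γ x P k.1 k.2) Θ θ) hv (fun k => hq k.1 k.2)]
  simp only [Fintype.sum_sigma]
  rfl

theorem det_fisherHessian_eq_zero (hx : ∀ j l, Measurable (x j l))
    (hP : ∀ θ ∈ Θ, IsProbabilityMeasure (P θ))
    (hindep : ∀ θ ∈ Θ, iIndepFun (fun (i : Σ j : Fin N, Fin (L j)) => x i.1 i.2) (P θ))
    (hD : (D : ℤ) > lambdaIndep R) (hθ : θ ∈ Θ)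
    (hu : ∀ᶠ η in 𝓝[Θ] θ, UniqueDiffWithinAt ℝ Θ η)
    (hq : ∀ j s, TwiceDifferentiableOn (outcomeProb γ x P j s) Θ)
    (h0 : ∀ j s, outcomeProb γ x P j s θ = 0 →
      ∀ᶠ η in 𝓝[Θ] θ, outcomeProb γ x P j s η = 0) :
    (fisherHessian γ x P Θ θ).det = 0 := by
  obtain ⟨v, hv, -, hd⟩ := exists_fderivWithin_eq_zero hx hP hindep hD hθ
    (hu.self_of_nhdsWithin hθ) fun j s => (hq j s).differentiableOn θ hθ
  have htwice : ∀ u : ∀ j, Outcome R j, TwiceDifferentiableOn (dataProb γ x P u) Θ := fun u =>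
    (TwiceDifferentiableOn.prod Finset.univ fun j => hq j (u j)).congr
      fun η hη => dataProb_eq_prod (hindep η hη) u
  have hzero : ∀ u : ∀ j, Outcome R j, dataProb γ x P u θ = 0 →
      ∀ᶠ η in 𝓝[Θ] θ, dataProb γ x P u η = 0 := by
    intro u h
    rw [dataProb_eq_prod (hindep θ hθ), Finset.prod_eq_zero_iff] at h
    obtain ⟨j, -, hj⟩ := h
    filter_upwards [h0 j (u j) hj, self_mem_nhdsWithin] with η hη hηΘ
    rw [dataProb_eq_prod (hindep η hηΘ)]
    exact Finset.prod_eq_zero (Finset.mem_univ j) hη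
  rw [← det_sum_rankOne_eq_zero (fun u : ∀ j, Outcome R j => 1 / dataProb γ x P u θ)
    (fun u => fderivWithin ℝ (dataProb γ x P u) Θ θ) hv hd]
  congr 1
  ext a b
  have hlog : ∀ u : ∀ j, Outcome R j,
      dataProb γ x P u θ * partialOn Θ a (partialOn Θ b (logLikelihood γ x P u)) θ = _ :=
    fun u => mul_partialOn_partialOn_log (htwice u) hθ hu (hzero u) a b
  simp only [fisherHessian, Matrix.of_apply]
  rw [Finset.sum_congr rfl fun u _ => hlog u, Finset.sum_sub_distrib,
    sum_partialOn_partialOn_eq_zero htwice hθ hu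
      (fun η hη => by have := hP η hη; exact sum_dataProb hx (hindep η hη)) a b, zero_sub, neg_neg]
  rfl

/-! ### Failure of identifiability. -/

theorem exists_observationallyEquivalent (hx : ∀ j l, Measurable (x j l))
    (hP : ∀ θ ∈ Θ, IsProbabilityMeasure (P θ))
    (hindep : ∀ θ ∈ Θ, iIndepFun (fun (i : Σ j : Fin N, Fin (L j)) => x i.1 i.2) (P θ))
    (hD : (D : ℤ) > lambdaIndep R) (hc : ∀ j s, ContinuousOn (outcomeProb γ x P j s) Θ)
    {U : Set (EuclideanSpace ℝ (Fin D))} (hUΘ : U ⊆ Θ) (hU : IsOpen U) (hne : U.Nonempty) :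
    ∃ θ ∈ U, ∃ θ' ∈ U, ObservationallyEquivalent γ x P θ θ' := by
  classical
  obtain ⟨θ₀, hθ₀⟩ := hne
  have := hP θ₀ (hUΘ hθ₀)
  obtain ⟨r₀⟩ := exists_referenceLevel (P := P) (θ := θ₀) γ x
  let f : EuclideanSpace ℝ (Fin D) → FreeLevel r₀ → ℝ :=
    fun θ i => levelProb γ x P i.1.1 i.1.2 i.2 θ
  have hf : ContinuousOn f U := by
    refine continuousOn_pi.2 fun i => ?_
    have h : ContinuousOn (fun η => ∑ s : Outcome R i.1.1 with s i.1.2 = i.2.1,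
        outcomeProb γ x P i.1.1 s η) U :=
      continuousOn_finsetSum _ fun s _ => (hc _ s).mono hUΘ
    refine h.congr fun η hη => ?_
    have := hP η (hUΘ hη)
    exact levelProb_eq_sum hx (hindep η (hUΘ hη)) i.1.1 i.1.2 i.2.1
  have hcard : Fintype.card (FreeLevel r₀) < Fintype.card (Fin D) := by
    have := card_freeLevel r₀
    rw [Fintype.card_fin]
    omega
  have hinj := not_injOn_of_continuousOn_of_card_lt hcard hU ⟨θ₀, hθ₀⟩ hf
  simp only [Set.InjOn, not_forall] at hinj
  obtain ⟨θ, hθ, θ', hθ', heq, hneq⟩ := hinj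
  have hfree : ∀ j l r, r ≠ r₀ j l → levelProb γ x P j l r θ = levelProb γ x P j l r θ' :=
    fun j l r hr => congrFun heq ⟨⟨j, l⟩, ⟨r, hr⟩⟩
  have hall : ∀ j l r, levelProb γ x P j l r θ = levelProb γ x P j l r θ' := by
    intro j l r
    by_cases hr : r = r₀ j l
    · have := hP θ (hUΘ hθ)
      have := hP θ' (hUΘ hθ')
      have h := (sum_levelProb (γ := γ) (P := P) (θ := θ) hx j l).trans
        (sum_levelProb (γ := γ) (P := P) (θ := θ') hx j l).symm
      rw [← Finset.add_sum_erase _ _ (Finset.mem_univ (r₀ j l)),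
        ← Finset.add_sum_erase _ _ (Finset.mem_univ (r₀ j l)),
        Finset.sum_congr rfl fun r hr => hfree j l r (Finset.ne_of_mem_erase hr)] at h
      rw [hr]
      exact add_right_cancel h
    · exact hfree j l r hr
  refine ⟨θ, hθ, θ', hθ', hneq, fun u => ?_⟩
  simp only [dataProb_eq_prod (hindep θ (hUΘ hθ)), dataProb_eq_prod (hindep θ' (hUΘ hθ')),
    outcomeProb_eq_prod (hindep θ (hUΘ hθ)), outcomeProb_eq_prod (hindep θ' (hUΘ hθ')), hall]

/-- If the bad points were finite in number, removing them would leave a nonempty open set, which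
would contain yet another one. -/
theorem infinite_not_identifiablePoint (hx : ∀ j l, Measurable (x j l))
    (hP : ∀ θ ∈ Θ, IsProbabilityMeasure (P θ))
    (hindep : ∀ θ ∈ Θ, iIndepFun (fun (i : Σ j : Fin N, Fin (L j)) => x i.1 i.2) (P θ))
    (hD : (D : ℤ) > lambdaIndep R) (hc : ∀ j s, ContinuousOn (outcomeProb γ x P j s) Θ)
    {U : Set (EuclideanSpace ℝ (Fin D))} (hUΘ : U ⊆ Θ) (hU : IsOpen U) (hne : U.Nonempty) :
    {θ ∈ U | ¬ IdentifiablePoint γ x P Θ θ}.Infinite := by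
  obtain ⟨θ₀, hθ₀⟩ := hne
  have := hP θ₀ (hUΘ hθ₀)
  obtain ⟨r₀⟩ := exists_referenceLevel (P := P) (θ := θ₀) γ x
  -- `lambdaIndep R` is a cardinality, hence nonnegative, so `D > 0` and nonempty open sets are
  -- infinite.
  have : Nonempty (Fin D) := ⟨⟨0, by have := card_freeLevel r₀; omega⟩⟩
  intro hfin
  have hUinf : U.Infinite := infinite_of_mem_nhds θ₀ (hU.mem_nhds hθ₀)
  obtain ⟨θ, hθ, θ', hθ', h⟩ := exists_observationallyEquivalent hx hP hindep hD hc
    (Set.sdiff_subset.trans hUΘ) (hU.sdiff hfin.isClosed) (hUinf.sdiff hfin).nonempty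
  exact hθ.2 ⟨hθ.1, fun h' => h' ⟨θ', hUΘ hθ'.1, h⟩⟩

end System

end

theorem theorem4 {N D : ℕ} {L : Fin N → ℕ} {R : ∀ j, Fin (L j) → ℕ}
    {X : ∀ j, Fin (L j) → Type*} [∀ j l, MeasurableSpace (X j l)]
    {Ω : Type*} [MeasurableSpace Ω]
    (γ : ∀ j l, VectorQuantizer (X j l) (R j l))
    (x : ∀ j l, Ω → X j l) (hx : ∀ j l, Measurable (x j l))
    (Θ : Set (EuclideanSpace ℝ (Fin D))) (hΘ : (interior Θ).Nonempty)
    (P : EuclideanSpace ℝ (Fin D) → Measure Ω)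
    (hP : ∀ θ ∈ Θ, IsProbabilityMeasure (P θ))
    (hindep : ∀ θ ∈ Θ, iIndepFun (fun (i : Σ j : Fin N, Fin (L j)) => x i.1 i.2) (P θ))
    (hD : (D : ℤ) > lambdaIndep R) :
    ((∀ j s, TwiceDifferentiableOn (outcomeProb γ x P j s) Θ) →
      (∀ θ ∈ Θ, UniqueDiffWithinAt ℝ Θ θ → (fisherGradient γ x P Θ θ).det = 0) ∧
      (∀ θ ∈ Θ, (∀ᶠ η in 𝓝[Θ] θ, UniqueDiffWithinAt ℝ Θ η) →
        (∀ j s, outcomeProb γ x P j s θ = 0 →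
          ∀ᶠ η in 𝓝[Θ] θ, outcomeProb γ x P j s η = 0) →
        (fisherHessian γ x P Θ θ).det = 0)) ∧
    ((∀ j s, ContinuousOn (outcomeProb γ x P j s) Θ) →
      ¬ IdentifiableSpace γ x P Θ ∧
      ∀ U ⊆ Θ, IsOpen U → U.Nonempty →
        {θ ∈ U | ¬ IdentifiablePoint γ x P Θ θ}.Infinite) := by
  refine ⟨fun hq => ⟨fun θ hθ hu => ?_, fun θ hθ hu h0 => ?_⟩, fun hc => ?_⟩
  · exact det_fisherGradient_eq_zero hx hP hindep hD hθ hu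
      fun j s => (hq j s).differentiableOn θ hθ
  · exact det_fisherHessian_eq_zero hx hP hindep hD hθ hu hq h0
  · have hinf : ∀ U ⊆ Θ, IsOpen U → U.Nonempty →
        {θ ∈ U | ¬ IdentifiablePoint γ x P Θ θ}.Infinite := fun U hUΘ hU hne =>
      infinite_not_identifiablePoint hx hP hindep hD hc hUΘ hU hne
    obtain ⟨θ, hθ, hnot⟩ := (hinf _ interior_subset isOpen_interior hΘ).nonempty
    exact ⟨fun h => hnot (h θ (interior_subset hθ)), hinf⟩
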